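/- An \emph{ordered groupoid} is a (small) groupoid internal to the category of posets whose domain map is a discrete fibration; here a monotone map of posets $f\colon P\to Q$ is a \emph{discrete fibration} if for all $y\in P$ and $x\le f(y)$ there is a unique $z\le y$ in $P$ with $f(z)=x$. For an ordered groupoid $G$ write $G_0$ for its poset of objects, $G_1$ for its poset of arrows, and $\mathbf d,\mathbf r\colon G_1\to G_0$ for domain and range. An \emph{étale $G$-set} is a poset $X$ with a discrete fibration $p\colon X\to G_0$ and a right action of $G$ on $X$ over $G_0$: for $x\in X$ and $g\in G_1$ with $p(x)=\mathbf r(g)$ there is given $x\cdot g\in X$ with $p(x\cdot g)=\mathbf d(g)$, the action is unital and associative, and $x\le y$, $g\le h$ imply $x\cdot g\le y\cdot h$ whenever both sides are defined. Morphisms of étale $G$-sets are the order-preserving equivariant maps over $G_0$. The \emph{classifying topos} $\mathscr B(G)$ is the category of étale $G$-sets. An \emph{ordered functor} is a functor that is monotone on objects and on arrows. An ordered functor $\theta\colon G\to K$ is a \emph{local isomorphism} if its underlying functor is full, faithful and essentially surjective, and its object map $\theta_0\colon G_0\to K_0$ is a discrete fibration. An ordered groupoid $K$ is an \emph{enlargement}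 of $G$ if $G$ is (identified with) a full subgroupoid of $K$ with the induced orders, $G$ is an order ideal of $K$, and every object of $K$ is isomorphic to an object of $G$. A \emph{joint bipartite enlargement} $[G,H]$ of ordered groupoids $G$ and $H$ is an ordered groupoid which is an enlargement of both $G$ and $H$, whose set of objects is the disjoint union of $G_0$ and $H_0$, and such that for each $e\in G_0$ there is an arrow $x$ with $\mathbf d(x)=e$ and $\mathbf r(x)\in H_0$, and for each $e\in H_0$ there is an arrow $x$ with $\mathbf d(x)=e$ and $\mathbf r(x)\in G_0$. \textbf{Theorem.} The following are equivalent for ordered groupoids $G$ and $H$: \begin{enumerate} \item[(1)] the classifying toposes $\mathscr B(G)$ and $\mathscr B(H)$ are equivalent categories; \item[(2)] $G$ and $H$ have a joint bipartite enlargement $[G,H]$; \item[(3)] there are an ordered groupoid $K$ and local isomorphisms $G\to K\leftarrow H$. \end{enumerate} -/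

import Mathlib

open CategoryTheory

universe u

attribute [local instance 2000] CategoryTheory.CategoryStruct.toQuiver

/-- A map of posets is a discrete fibration if it is monotone and every `x ≤ f y` has a unique
lift to an element below `y`. -/
structure IsDiscreteFibration {P Q : Type*} [PartialOrder P] [PartialOrder Q] (f : P → Q) :
    Prop where
  monotone : Monotone f
  existsUnique_lift : ∀ (y : P) (x : Q), x ≤ f y → ∃! z : P, z ≤ y ∧ f z = x

/-- An ordered groupoid: a groupoid internal to the category of posets whose domain map is a
discrete fibration. `G` is the poset of objects; the order on the set of all arrows is given by
the relation `ArrLE` between arrows with arbitrary end points. -/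
class OrderedGroupoid (G : Type u) extends Groupoid.{u} G, PartialOrder G where
  /-- the partial order on the set of all arrows -/
  ArrLE : ∀ {a b c d : G}, (a ⟶ b) → (c ⟶ d) → Prop
  arrLE_refl : ∀ {a b : G} (f : a ⟶ b), ArrLE f f
  arrLE_trans : ∀ {a b c d a' b' : G} (f : a ⟶ b) (g : c ⟶ d) (h : a' ⟶ b'),
    ArrLE f g → ArrLE g h → ArrLE f h
  /-- antisymmetry; by `dom_mono` and `cod_mono` two arrows, each below the other,
  have the same end points, so that it suffices to consider parallel arrows -/
  arrLE_antisymm : ∀ {a b : G} (f g : a ⟶ b), ArrLE f g → ArrLE g f → f = g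
  dom_mono : ∀ {a b c d : G} (f : a ⟶ b) (g : c ⟶ d), ArrLE f g → a ≤ c
  cod_mono : ∀ {a b c d : G} (f : a ⟶ b) (g : c ⟶ d), ArrLE f g → b ≤ d
  id_mono : ∀ {a b : G}, a ≤ b → ArrLE (𝟙 a) (𝟙 b)
  inv_mono : ∀ {a b c d : G} (f : a ⟶ b) (g : c ⟶ d), ArrLE f g →
    ArrLE (Groupoid.inv f) (Groupoid.inv g)
  comp_mono : ∀ {a b c a' b' c' : G} (f : a ⟶ b) (g : b ⟶ c) (f' : a' ⟶ b') (g' : b' ⟶ c'),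
    ArrLE f f' → ArrLE g g' → ArrLE (f ≫ g) (f' ≫ g')
  /-- the domain map is a discrete fibration: unique restriction of an arrow to an object below
  its domain -/
  existsUnique_restrict : ∀ {c d : G} (g : c ⟶ d) (a : G), a ≤ c →
    ∃! f : (Σ b : G, a ⟶ b), ArrLE f.2 g

namespace OrderedGroupoid

/-! ### Étale actions and the classifying topos -/

/-- An étale (right) `G`-set of an ordered groupoid `G`: a poset `X` with a discrete fibration
`p : X → G` to the poset of objects (equivalently, a space étale over the objects of `G` for the
Alexandrov topologies), and an order-preserving (i.e. continuous) right action of the arrows of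
`G`: if `g : a ⟶ b` and `p x = b`, then `x · g` is defined and lies over `a`. -/
structure EtaleSet (G : Type u) [OrderedGroupoid G] where
  carrier : Type u
  [order : PartialOrder carrier]
  p : carrier → G
  isDiscreteFibration : IsDiscreteFibration p
  act : ∀ (x : carrier) {a b : G} (_ : a ⟶ b), p x = b → carrier
  p_act : ∀ (x : carrier) {a b : G} (g : a ⟶ b) (h : p x = b), p (act x g h) = a
  act_id : ∀ (x : carrier) {b : G} (h : p x = b), act x (𝟙 b) h = x
  act_comp : ∀ (x : carrier) {a b c : G} (f : a ⟶ b) (g : b ⟶ c) (h : p x = c),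
    act x (f ≫ g) h = act (act x g h) f (p_act x g h)
  act_mono : ∀ (x y : carrier) {a b c d : G} (f : a ⟶ b) (g : c ⟶ d) (hx : p x = b)
    (hy : p y = d), x ≤ y → ArrLE f g → act x f hx ≤ act y g hy

attribute [instance] EtaleSet.order

/-- A morphism of étale `G`-sets: an order-preserving map over the objects of `G` that commutes
with the actions. -/
@[ext]
structure EtaleSet.Hom {G : Type u} [OrderedGroupoid G] (X Y : EtaleSet G) where
  toFun : X.carrier → Y.carrier
  monotone : Monotone toFun
  p_toFun : ∀ x, Y.p (toFun x) = X.p x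
  toFun_act : ∀ (x : X.carrier) {a b : G} (g : a ⟶ b) (h : X.p x = b),
    toFun (X.act x g h) = Y.act (toFun x) g ((p_toFun x).trans h)

/-- The classifying topos of `G` is the category `EtaleSet G` of étale `G`-sets. -/
instance EtaleSet.category (G : Type u) [OrderedGroupoid G] : Category.{u} (EtaleSet G) where
  Hom X Y := EtaleSet.Hom X Y
  id X := ⟨fun x => x, fun _ _ h => h, fun _ => rfl, fun _ _ _ _ _ => rfl⟩
  comp F K := ⟨fun x => K.toFun (F.toFun x), fun _ _ h => K.monotone (F.monotone h),
    fun x => (K.p_toFun _).trans (F.p_toFun x),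
    fun x _ _ g h => by rw [F.toFun_act x g h, K.toFun_act]⟩

/-! ### Local isomorphisms and enlargements -/

section

variable {G H K : Type u} [OrderedGroupoid G] [OrderedGroupoid H] [OrderedGroupoid K]

/-- An ordered functor: a functor that preserves the orders on objects and on arrows. -/
structure IsOrderedFunctor (F : G ⥤ H) : Prop where
  obj_mono : ∀ {a b : G}, a ≤ b → F.obj a ≤ F.obj b
  map_mono : ∀ {a b c d : G} (f : a ⟶ b) (g : c ⟶ d), ArrLE f g → ArrLE (F.map f) (F.map g)

/-- A local isomorphism: an ordered functor whose underlying functor is a weak equivalence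
(full, faithful, essentially surjective) and whose object map is a discrete fibration. -/
structure IsLocalIsomorphism (F : G ⥤ H) : Prop where
  isOrderedFunctor : IsOrderedFunctor F
  full : F.Full
  faithful : F.Faithful
  essSurj : F.EssSurj
  isDiscreteFibration_obj : IsDiscreteFibration F.obj

/-- `K` is an enlargement of `G` along `i`: the functor `i` identifies `G`, as an ordered
groupoid, with a full subgroupoid of `K` carrying the induced orders, its set of objects
is an order ideal, and every object of `K` is isomorphic to one of `G`.  (As the subgroupoid
is full, its set of arrows is then an order ideal, too.) -/
structure IsEnlargement (i : G ⥤ K) : Prop where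
  injective_obj : Function.Injective i.obj
  obj_le_iff : ∀ {a b : G}, i.obj a ≤ i.obj b ↔ a ≤ b
  map_le_iff : ∀ {a b c d : G} (f : a ⟶ b) (g : c ⟶ d), ArrLE (i.map f) (i.map g) ↔ ArrLE f g
  full : i.Full
  faithful : i.Faithful
  isLowerSet_range : IsLowerSet (Set.range i.obj)
  exists_iso : ∀ k : K, ∃ a : G, Nonempty (i.obj a ≅ k)

/-- `K` is a joint bipartite enlargement `[G, H]` along `i` and `j`: it is an enlargement of
both, its set of objects is the disjoint union of those of `G` and of `H`, and every object of
`G` is the domain of an arrow to an object of `H`, and vice versa. -/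
structure IsBipartiteEnlargement (i : G ⥤ K) (j : H ⥤ K) : Prop where
  left : IsEnlargement i
  right : IsEnlargement j
  isCompl_range : IsCompl (Set.range i.obj) (Set.range j.obj)
  exists_arrow_left : ∀ a : G, ∃ b : H, Nonempty (i.obj a ⟶ j.obj b)
  exists_arrow_right : ∀ b : H, ∃ a : G, Nonempty (j.obj b ⟶ i.obj a)

end

end OrderedGroupoid

/-!
An ordered groupoid `G` has a category of monomorphisms `MonoCat G` with the same objects, whose
morphisms `X ⟶ Y` are the arrows of `G` from `X` to an object below `Y`.  Each of its morphisms is a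
monomorphism and factors uniquely as an arrow of `G`, which is an isomorphism, followed by an
inequality; the isomorphisms are exactly the arrows of `G`.  The equivalence of the three
conditions comes down to `MonoCat G ≌ MonoCat H`.

* An étale `G`-set is the same as a presheaf on `MonoCat G`: inequalities act by the unique lifts
  of the discrete fibration, and arrows act by the given action (`EtaleSet.toPresheaf`).  So
  equivalent categories of monomorphisms give equivalent classifying toposes.
* Conversely, if the presheaf categories are equivalent, the image of a representable presheaf is
  projective and indecomposable, hence a retract of a representable one.  An idempotent that is a
  monomorphism is an identity, so the image is itself representable, and the equivalence restricts
  to the Yoneda images (`nonempty_equivalence_of_presheaf`).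
* A local isomorphism induces an equivalence of the categories of monomorphisms: the weak
  equivalence accounts for the arrows of the groupoid and the discrete fibration for the
  inequalities (`IsLocalIsomorphism.nonempty_equivalence`).
* Given `E : MonoCat G ≌ MonoCat H`, a joint bipartite enlargement has the disjoint union of the
  posets of objects as its objects, and as its arrows the isomorphisms of `MonoCat H` between the
  images of these objects under `E` and the identity, ordered by commutation with inequalities
  (`exists_isBipartiteEnlargement`).  The unique factorization of morphisms is what makes its domain
  map a discrete fibration.
* The two inclusions into a joint bipartite enlargement are local isomorphisms.
-/

open Opposite

/-! ### Morita equivalence of categories of monomorphisms -/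

section Presheaf

variable {C D : Type u} [Category.{u} C] [Category.{u} D]

/-- Representable presheaves are projective and indecomposable at once: a jointly epimorphic family
into one of them has a member that is a split epimorphism. -/
lemma exists_section_of_jointly_epi {ι : Type*} {c : C} {A : ι → Cᵒᵖ ⥤ Type u}
    (ψ : ∀ i, A i ⟶ yoneda.obj c)
    (hψ : ∀ (Q : Cᵒᵖ ⥤ Type u) (g h : yoneda.obj c ⟶ Q),
      (∀ i, ψ i ≫ g = ψ i ≫ h) → g = h) :
    ∃ i, ∃ s : yoneda.obj c ⟶ A i, s ≫ ψ i = 𝟙 _ := by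
  -- The union of the images is a subpresheaf of the representable presheaf, that is, a sieve.
  let S : Sieve c :=
    { arrows := fun Y g => ∃ i, ∃ z : (A i).obj (op Y), (ψ i).app (op Y) z = g
      downward_closed := by
        rintro Y Z _ ⟨i, z, rfl⟩ f
        exact ⟨i, (A i).map f.op z, NatTrans.naturality_apply (ψ i) f.op z⟩ }
  have hfac : ∀ i, ∃ t : A i ⟶ S.functor, t ≫ S.functorInclusion = ψ i := by
    intro i
    refine ⟨{ app := fun Y => ↾fun z => ⟨(ψ i).app Y z, i, z, rfl⟩, naturality := ?_ }, ?_⟩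
    · intro X Y f
      ext z
      apply Subtype.ext
      exact NatTrans.naturality_apply (ψ i) f z
    · ext Y z
      rfl
  have hepi : Epi S.functorInclusion := by
    constructor
    intro Q g h hgh
    apply hψ
    intro i
    obtain ⟨t, ht⟩ := hfac i
    rw [← ht, Category.assoc, Category.assoc, hgh]
  have hsurj := (epi_iff_surjective _).1 ((NatTrans.epi_iff_epi_app _).1 hepi (op c))
  obtain ⟨⟨_, i, z, hz⟩, h₁⟩ := hsurj (𝟙 c)
  obtain rfl : _ = 𝟙 c := h₁
  refine ⟨i, yonedaEquiv.symm z, ?_⟩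
  rw [yonedaEquiv_symm_naturality_right]
  apply yonedaEquiv.injective
  rw [Equiv.apply_symm_apply]
  exact hz

/-- If all morphisms of `D` are monomorphisms, then an equivalence of presheaf categories preserves
representability: the image of a representable presheaf is a retract of a representable presheaf
`yoneda.obj d`, and the idempotent of `d` that this gives is the identity, being a monomorphism. -/
lemma exists_iso_yoneda_obj (hD : ∀ {x y : D} (f : x ⟶ y), Mono f)
    (E : (Cᵒᵖ ⥤ Type u) ≌ (Dᵒᵖ ⥤ Type u)) (c : C) :
    ∃ d : D, Nonempty (yoneda.obj d ≅ E.functor.obj (yoneda.obj c)) := by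
  let P := E.functor.obj (yoneda.obj c)
  let φ : ∀ i : (Σ d : D, P.obj (op d)), yoneda.obj i.1 ⟶ P := fun i => yonedaEquiv.symm i.2
  obtain ⟨⟨d, x⟩, s, hs⟩ := exists_section_of_jointly_epi
    (fun i => E.inverse.map (φ i) ≫ E.unitInv.app (yoneda.obj c)) (by
      intro Q g h hgh
      -- The maps `φ i` pick out all elements of `P`, so they are jointly epimorphic.
      apply E.functor.map_injective
      ext Y x
      have h₁ := hgh ⟨Y.unop, x⟩
      have h₂ := congrArg E.functor.map h₁
      simp only [Functor.map_comp, Category.assoc] at h₂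
      have h₃ : φ ⟨Y.unop, x⟩ ≫ E.functor.map g = φ ⟨Y.unop, x⟩ ≫ E.functor.map h := by
        simpa [Equivalence.fun_inv_map, P] using h₂
      have h₄ := congrArg yonedaEquiv h₃
      rwa [yonedaEquiv_comp, yonedaEquiv_comp, Equiv.apply_symm_apply] at h₄)
  -- Back in presheaves on `D`, the section exhibits `P` as a retract of `yoneda.obj d`.
  let r : yoneda.obj d ⟶ P := φ ⟨d, x⟩
  obtain ⟨t, ht⟩ : ∃ t : P ⟶ yoneda.obj d, t ≫ r = 𝟙 P := by
    refine ⟨E.functor.map s ≫ E.counit.app _, ?_⟩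
    have h := congrArg E.functor.map hs
    simpa [Equivalence.fun_inv_map, P, r] using h
  refine ⟨d, ⟨⟨r, t, ?_, ht⟩⟩⟩
  obtain ⟨e, he⟩ := yoneda.map_surjective (r ≫ t)
  have hee : e ≫ e = 𝟙 d ≫ e := by
    apply yoneda.map_injective
    rw [Functor.map_comp, Category.id_comp, he, Category.assoc, reassoc_of% ht]
  have := hD e
  rw [← he, (cancel_mono e).1 hee, CategoryTheory.Functor.map_id]

/-- Categories of monomorphisms are determined by their presheaf categories. -/
theorem nonempty_equivalence_of_presheaf (hC : ∀ {x y : C} (f : x ⟶ y), Mono f)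
    (hD : ∀ {x y : D} (f : x ⟶ y), Mono f)
    (E : (Cᵒᵖ ⥤ Type u) ≌ (Dᵒᵖ ⥤ Type u)) : Nonempty (C ≌ D) := by
  have hmem : ∀ c, (yoneda (C := D)).essImage ((yoneda ⋙ E.functor).obj c) :=
    fun c => exists_iso_yoneda_obj hD E c
  let F : C ⥤ D := Functor.essImage.liftFunctor _ _ hmem
  let α : F ⋙ yoneda ≅ yoneda ⋙ E.functor := Functor.essImage.liftFunctorCompIso _ _ hmem
  have h₁ : (F ⋙ yoneda).Full := Functor.Full.of_iso α.symm
  have h₂ : (F ⋙ yoneda).Faithful := Functor.Faithful.of_iso α.symm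
  have : F.Full := Functor.Full.of_comp_faithful F yoneda
  have : F.Faithful := Functor.Faithful.of_comp F yoneda
  have : F.EssSurj := by
    refine ⟨fun d => ?_⟩
    obtain ⟨c, ⟨e⟩⟩ := exists_iso_yoneda_obj hC E.symm d
    exact ⟨c, ⟨yoneda.preimageIso
      (α.app c ≪≫ E.functor.mapIso e ≪≫ E.counitIso.app (yoneda.obj d))⟩⟩
  have : F.IsEquivalence := { }
  exact ⟨F.asEquivalence⟩

end Presheaf

namespace OrderedGroupoid

/-! ### Restriction of arrows -/

section Restriction

variable {G : Type u} [OrderedGroupoid G]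

/-- Arrows with a common domain that lie below a common arrow are equal. -/
lemma ArrLE.sigma_ext {a b b' c d : G} {f : a ⟶ b} {f' : a ⟶ b'} {g : c ⟶ d}
    (hf : ArrLE f g) (hf' : ArrLE f' g) : (⟨b, f⟩ : Σ b : G, a ⟶ b) = ⟨b', f'⟩ :=
  (existsUnique_restrict g a (dom_mono f g hf)).unique hf hf'

/-- The restriction of an arrow to an object below its domain. -/
noncomputable def restrict {c d : G} (g : c ⟶ d) {a : G} (h : a ≤ c) : Σ b : G, a ⟶ b :=
  (existsUnique_restrict g a h).choose

lemma arrLE_restrict {c d : G} (g : c ⟶ d) {a : G} (h : a ≤ c) : ArrLE (restrict g h).2 g :=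
  (existsUnique_restrict g a h).choose_spec.1

lemma ArrLE.of_sigma_eq {a b b' c d : G} {f : a ⟶ b} {f' : a ⟶ b'} {g : c ⟶ d}
    (h : (⟨b, f⟩ : Σ b : G, a ⟶ b) = ⟨b', f'⟩) (hf' : ArrLE f' g) : ArrLE f g := by
  cases h
  exact hf'

end Restriction

/-! ### The category of monomorphisms of an ordered groupoid -/

/-- The objects of the left cancellative category `MonoCat G` of an ordered groupoid `G`: those
of `G`.  The wrapper keeps its morphisms apart from the arrows of `G`. -/
structure MonoCat (G : Type u) where
  /-- the underlying object of `G` -/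
  obj : G

namespace MonoCat

variable {G : Type u} [OrderedGroupoid G]

/-- A morphism `X ⟶ Y` in `MonoCat G` is an arrow of `G` from `X` to some object below `Y`. -/
@[ext]
structure Hom (X Y : MonoCat G) where
  /-- the underlying arrow, together with its codomain -/
  toSigma : Σ b : G, X.obj ⟶ b
  le : toSigma.1 ≤ Y.obj

/-- The composite of `f : X ⟶ b ≤ Y` with `g : Y ⟶ c ≤ Z` is `f` followed by the restriction of `g`
to `b`. -/
noncomputable def Hom.comp {X Y Z : MonoCat G} (f : Hom X Y) (g : Hom Y Z) : Hom X Z :=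
  ⟨⟨_, f.toSigma.2 ≫ (restrict g.toSigma.2 f.le).2⟩,
    (cod_mono _ _ (arrLE_restrict g.toSigma.2 f.le)).trans g.le⟩

/-- Composites may be computed with any arrow known to be a restriction of the second factor. -/
lemma Hom.toSigma_comp {X Y Z : MonoCat G} (f : Hom X Y) (g : Hom Y Z) {b : G}
    (k : f.toSigma.1 ⟶ b) (hk : ArrLE k g.toSigma.2) :
    (f.comp g).toSigma = ⟨b, f.toSigma.2 ≫ k⟩ := by
  have h := ArrLE.sigma_ext (arrLE_restrict g.toSigma.2 f.le) hk
  exact congrArg (fun s : Σ b : G, f.toSigma.1 ⟶ b =>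
    (⟨s.1, f.toSigma.2 ≫ s.2⟩ : Σ b : G, X.obj ⟶ b)) h

noncomputable instance : Category.{u} (MonoCat G) where
  Hom X Y := Hom X Y
  id X := ⟨⟨X.obj, 𝟙 X.obj⟩, le_rfl⟩
  comp f g := f.comp g
  id_comp f := by
    apply Hom.ext
    rw [Hom.toSigma_comp _ _ f.toSigma.2 (arrLE_refl _), Category.id_comp]
  comp_id f := by
    apply Hom.ext
    rw [Hom.toSigma_comp _ _ (𝟙 _) (id_mono f.le), Category.comp_id]
  assoc {X Y Z W} f g h := by
    apply Hom.ext
    let k := (restrict g.toSigma.2 f.le).2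
    have hk : ArrLE k g.toSigma.2 := arrLE_restrict g.toSigma.2 f.le
    let l := (restrict h.toSigma.2 g.le).2
    have hl : ArrLE l h.toSigma.2 := arrLE_restrict h.toSigma.2 g.le
    have hkl := arrLE_restrict l (cod_mono _ _ hk)
    rw [Hom.toSigma_comp (f.comp g) h (restrict l (cod_mono _ _ hk)).2
        (arrLE_trans _ _ _ hkl hl),
      Hom.toSigma_comp f (g.comp h) (k ≫ (restrict l (cod_mono _ _ hk)).2)
        (comp_mono _ _ _ _ hk hkl), ← Category.assoc]
    rfl

lemma hom_ext {X Y : MonoCat G} {f g : X ⟶ Y} (h : Hom.toSigma f = Hom.toSigma g) : f = g :=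
  Hom.ext h

lemma toSigma_comp {X Y Z : MonoCat G} (f : X ⟶ Y) (g : Y ⟶ Z) {b : G}
    (k : (Hom.toSigma f).1 ⟶ b) (hk : ArrLE k (Hom.toSigma g).2) :
    Hom.toSigma (f ≫ g) = ⟨b, (Hom.toSigma f).2 ≫ k⟩ :=
  Hom.toSigma_comp f g k hk

/-- The morphism of `MonoCat G` given by an arrow whose codomain lies below the target. -/
def homMk {X Y : MonoCat G} {b : G} (f : X.obj ⟶ b) (h : b ≤ Y.obj) : X ⟶ Y :=
  (⟨⟨b, f⟩, h⟩ : Hom X Y)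

lemma exists_homMk {X Y : MonoCat G} (f : X ⟶ Y) :
    ∃ (b : G) (k : X.obj ⟶ b) (h : b ≤ Y.obj), f = homMk k h :=
  ⟨_, _, Hom.le f, rfl⟩

lemma homMk_comp {X Y Z : MonoCat G} {b c c' : G} {f : X.obj ⟶ b} (hf : b ≤ Y.obj)
    {g : Y.obj ⟶ c} (hg : c ≤ Z.obj) (k : b ⟶ c') (hk : ArrLE k g) :
    homMk f hf ≫ homMk g hg = homMk (Y := Z) (f ≫ k) ((cod_mono _ _ hk).trans hg) :=
  hom_ext (toSigma_comp (homMk f hf) (homMk g hg) k hk)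

lemma sigma_eq_of_homMk_eq {X Y : MonoCat G} {b c : G} {f : X.obj ⟶ b} {g : X.obj ⟶ c}
    {hf : b ≤ Y.obj} {hg : c ≤ Y.obj} (h : homMk f hf = homMk (Y := Y) g hg) :
    (⟨b, f⟩ : Σ b : G, X.obj ⟶ b) = ⟨c, g⟩ :=
  congrArg Hom.toSigma h

/-- The identity-on-objects functor from `G` to `MonoCat G`. -/
def ofArrow (G : Type u) [OrderedGroupoid G] : G ⥤ MonoCat G where
  obj a := ⟨a⟩
  map {a b} f := homMk (X := ⟨a⟩) (Y := ⟨b⟩) f le_rfl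
  map_id _ := rfl
  map_comp _ g := (homMk_comp (X := ⟨_⟩) (Y := ⟨_⟩) (Z := ⟨_⟩) _ _ g (arrLE_refl g)).symm

/-- The morphism of `MonoCat G` given by an inequality between objects of `G`. -/
def ofLE {a b : G} (h : a ≤ b) : (ofArrow G).obj a ⟶ (ofArrow G).obj b :=
  homMk (X := ⟨a⟩) (Y := ⟨b⟩) (𝟙 a) h

lemma ofLE_refl (a : G) : ofLE (le_refl a) = 𝟙 _ := rfl

lemma ofLE_comp_ofLE {a b c : G} (h : a ≤ b) (h' : b ≤ c) :
    ofLE h ≫ ofLE h' = ofLE (h.trans h') :=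
  hom_ext ((toSigma_comp _ _ (𝟙 a) (id_mono h)).trans
    (congrArg (Sigma.mk a) (Category.comp_id (𝟙 a))))

lemma ofArrow_comp_ofLE {a b c : G} (f : a ⟶ b) (h : b ≤ c) :
    (ofArrow G).map f ≫ ofLE h = homMk (X := ⟨a⟩) (Y := ⟨c⟩) f h :=
  hom_ext ((toSigma_comp ((ofArrow G).map f) (ofLE h) (𝟙 b) (arrLE_refl (𝟙 b))).trans
    (congrArg (Sigma.mk b) (Category.comp_id f)))

lemma ofLE_comp_homMk {a b c d e : G} (h : a ≤ b) {f : a ⟶ c} {g : b ⟶ d} (hg : d ≤ e)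
    (hfg : ArrLE f g) :
    ofLE h ≫ homMk (X := ⟨b⟩) (Y := ⟨e⟩) g hg =
      homMk (X := ⟨a⟩) (Y := ⟨e⟩) f ((cod_mono _ _ hfg).trans hg) :=
  hom_ext ((toSigma_comp _ _ f hfg).trans (congrArg (Sigma.mk c) (Category.id_comp f)))

/-- The order on the arrows of `G` is recovered from `MonoCat G`. -/
lemma arrLE_iff {a b c d : G} (f : a ⟶ b) (g : c ⟶ d) :
    ArrLE f g ↔ ∃ (hac : a ≤ c) (hbd : b ≤ d),
      (ofArrow G).map f ≫ ofLE hbd = ofLE hac ≫ (ofArrow G).map g := by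
  constructor
  · intro h
    refine ⟨dom_mono _ _ h, cod_mono _ _ h, ?_⟩
    rw [ofArrow_comp_ofLE]
    exact (ofLE_comp_homMk (dom_mono _ _ h) le_rfl h).symm
  · rintro ⟨hac, hbd, h⟩
    have hr := arrLE_restrict g hac
    rw [ofArrow_comp_ofLE] at h
    exact .of_sigma_eq (sigma_eq_of_homMk_eq (h.trans (ofLE_comp_homMk hac le_rfl hr))) hr

instance mono_hom {X Y : MonoCat G} (f : X ⟶ Y) : Mono f := by
  refine ⟨fun {Z} g g' h => ?_⟩
  obtain ⟨c, k, hc, rfl⟩ := exists_homMk f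
  obtain ⟨b, l, hb, rfl⟩ := exists_homMk g
  obtain ⟨b', l', hb', rfl⟩ := exists_homMk g'
  have hr := arrLE_restrict k hb
  have hr' := arrLE_restrict k hb'
  rw [homMk_comp hb hc _ hr, homMk_comp hb' hc _ hr'] at h
  have hs := sigma_eq_of_homMk_eq h
  -- The inverses of the two restrictions of `k` have a common domain and lie below `k⁻¹`.
  have hi := inv_mono _ _ hr
  have hi' := inv_mono _ _ hr'
  generalize restrict k hb = r at *
  generalize restrict k hb' = r' at *
  obtain ⟨e, r⟩ := r
  obtain ⟨e', r'⟩ := r'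
  obtain rfl : e = e' := congrArg Sigma.fst hs
  obtain rfl : b = b' := congrArg Sigma.fst (ArrLE.sigma_ext hi hi')
  obtain rfl : r = r' := by
    have := ArrLE.sigma_ext hr hr'
    simpa using this
  obtain rfl : l = l' := by simpa [cancel_mono] using hs
  rfl

instance : (ofArrow G).Faithful where
  map_injective h := by simpa using sigma_eq_of_homMk_eq h

/-- All isomorphisms of `MonoCat G` come from arrows of `G`: composing with the inverse shows that
the inequality involved is an equality. -/
lemma exists_ofArrow_map_eq {a b : G} (e : (ofArrow G).obj a ≅ (ofArrow G).obj b) :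
    ∃ f : a ⟶ b, (ofArrow G).map f = e.hom := by
  obtain ⟨c, f, hc, hf⟩ := exists_homMk e.hom
  obtain ⟨d, g, hd, hg⟩ := exists_homMk e.inv
  have h := e.inv_hom_id
  have hr := arrLE_restrict f hd
  rw [hf, hg, homMk_comp hd hc _ hr] at h
  have h₁ : (restrict f hd).1 = b := congrArg Sigma.fst (congrArg Hom.toSigma h)
  -- The restriction of `f` in the composite `𝟙 = e.inv ≫ e.hom` ends at `b`; hence `b ≤ c`.
  obtain rfl : c = b := le_antisymm hc (h₁ ▸ cod_mono _ _ hr)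
  exact ⟨f, hf.symm⟩

/-- Every morphism of `MonoCat G` factors uniquely as an isomorphism followed by an inequality. -/
lemma existsUnique_factorization (p : G) {X : MonoCat G} (f : X ⟶ (ofArrow G).obj p) :
    ∃! q : G, ∃ (h : q ≤ p) (e : X ≅ (ofArrow G).obj q), e.hom ≫ ofLE h = f := by
  obtain ⟨x⟩ := X
  change (ofArrow G).obj x ⟶ _ at f
  change ∃! q : G, ∃ (h : q ≤ p) (e : (ofArrow G).obj x ≅ _), _
  obtain ⟨b, k, hb, rfl⟩ := exists_homMk f
  refine ⟨b, ⟨hb, (ofArrow G).mapIso (Groupoid.isoEquivHom _ _ |>.symm k),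
    ofArrow_comp_ofLE k hb⟩, ?_⟩
  rintro q ⟨h, e, he⟩
  obtain ⟨l, hl⟩ := exists_ofArrow_map_eq e
  have h₁ := (ofArrow_comp_ofLE l h).symm.trans ((congrArg (· ≫ ofLE h) hl).trans he)
  exact congrArg Sigma.fst (sigma_eq_of_homMk_eq h₁)

end MonoCat

/-! ### Étale sets as presheaves -/

namespace EtaleSet

open MonoCat

variable {G : Type u} [OrderedGroupoid G]

/-- An étale `G`-set carries an action of the morphisms `A ⟶ b ≤ B` of `MonoCat G`: an element over
`B` is first restricted to `b` and then acted on. -/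
noncomputable def actHom (X : EtaleSet G) {A B : MonoCat G} (f : A ⟶ B) (x : X.carrier)
    (h : X.p x = B.obj) : X.carrier :=
  X.act (X.isDiscreteFibration.existsUnique_lift x _ ((Hom.le f).trans h.ge)).choose
    (Hom.toSigma f).2
    (X.isDiscreteFibration.existsUnique_lift x _ ((Hom.le f).trans h.ge)).choose_spec.1.2

lemma actHom_eq (X : EtaleSet G) {A B : MonoCat G} {f : A ⟶ B} {x y : X.carrier}
    (h : X.p x = B.obj) {b : G} {k : A.obj ⟶ b} (hf : Hom.toSigma f = ⟨b, k⟩) (hyx : y ≤ x)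
    (hy : X.p y = b) : X.actHom f x h = X.act y k hy := by
  obtain ⟨⟨b', k'⟩, hb⟩ := f
  cases hf
  have hu := X.isDiscreteFibration.existsUnique_lift x b (hb.trans h.ge)
  have : hu.choose = y := hu.unique hu.choose_spec.1 ⟨hyx, hy⟩
  subst this
  rfl

lemma exists_actHom_eq (X : EtaleSet G) {A B : MonoCat G} (f : A ⟶ B) (x : X.carrier)
    (h : X.p x = B.obj) : ∃ (y : X.carrier) (hy : X.p y = (Hom.toSigma f).1), y ≤ x ∧
      X.actHom f x h = X.act y (Hom.toSigma f).2 hy :=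
  ⟨_, _, (X.isDiscreteFibration.existsUnique_lift x _ ((Hom.le f).trans h.ge)).choose_spec.1.1, rfl⟩

lemma p_actHom (X : EtaleSet G) {A B : MonoCat G} (f : A ⟶ B) (x : X.carrier)
    (h : X.p x = B.obj) : X.p (X.actHom f x h) = A.obj :=
  X.p_act _ _ _

lemma actHom_comp (X : EtaleSet G) {A B C : MonoCat G} (f : A ⟶ B) (g : B ⟶ C) (x : X.carrier)
    (h : X.p x = C.obj) :
    X.actHom (f ≫ g) x h = X.actHom f (X.actHom g x h) (X.p_actHom g x h) := by
  obtain ⟨y, hy, hyx, hgx⟩ := X.exists_actHom_eq g x h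
  -- With `x` restricted to `y` and `y` to `z`, both sides act on `z`.
  have hk := arrLE_restrict (Hom.toSigma g).2 (Hom.le f)
  obtain ⟨z, ⟨hzy, hz⟩, -⟩ :=
    X.isDiscreteFibration.existsUnique_lift y _ ((cod_mono _ _ hk).trans hy.ge)
  rw [X.actHom_eq h (toSigma_comp f g _ hk) (hzy.trans hyx) hz, X.act_comp]
  refine (X.actHom_eq _ rfl ?_ _).symm
  rw [hgx]
  exact X.act_mono _ _ _ _ _ _ hzy hk

lemma actHom_ofArrow (X : EtaleSet G) {a b : G} (g : a ⟶ b) (x : X.carrier) (h : X.p x = b) :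
    X.actHom ((ofArrow G).map g) x h = X.act x g h :=
  X.actHom_eq h rfl le_rfl h

lemma actHom_id (X : EtaleSet G) {A : MonoCat G} (x : X.carrier) (h : X.p x = A.obj) :
    X.actHom (𝟙 A) x h = x :=
  (X.actHom_ofArrow (𝟙 A.obj) x h).trans (X.act_id x h)

lemma actHom_ofLE (X : EtaleSet G) {a b : G} (hab : a ≤ b) {x y : X.carrier} (hyx : y ≤ x)
    (h : X.p x = b) (hy : X.p y = a) : X.actHom (ofLE hab) x h = y :=
  (X.actHom_eq h rfl hyx hy).trans (X.act_id y hy)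

lemma actHom_ofLE_le (X : EtaleSet G) {a b : G} (hab : a ≤ b) (x : X.carrier) (h : X.p x = b) :
    X.actHom (ofLE hab) x h ≤ x := by
  obtain ⟨y, ⟨hyx, hy⟩, -⟩ := X.isDiscreteFibration.existsUnique_lift x a (hab.trans h.ge)
  rwa [X.actHom_ofLE hab hyx h hy]

lemma Hom.map_actHom {X Y : EtaleSet G} (F : Hom X Y) {A B : MonoCat G} (f : A ⟶ B)
    (x : X.carrier) (h : X.p x = B.obj) :
    F.toFun (X.actHom f x h) = Y.actHom f (F.toFun x) ((F.p_toFun x).trans h) := by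
  obtain ⟨y, hy, hyx, hfx⟩ := X.exists_actHom_eq f x h
  rw [hfx, F.toFun_act]
  exact (Y.actHom_eq _ rfl (F.monotone hyx) _).symm

/-- The presheaf of fibres of an étale `G`-set. -/
noncomputable def fibres (X : EtaleSet G) : (MonoCat G)ᵒᵖ ⥤ Type u where
  obj A := {x : X.carrier // X.p x = A.unop.obj}
  map f := ↾fun x => ⟨X.actHom f.unop x.1 x.2, X.p_actHom f.unop x.1 x.2⟩
  map_id A := by
    ext x
    exact X.actHom_id x.1 x.2
  map_comp f g := by
    ext x
    exact X.actHom_comp g.unop f.unop x.1 x.2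

/-- The comparison functor, taking fibres, from étale `G`-sets to presheaves on `MonoCat G`. -/
noncomputable def toPresheaf (G : Type u) [OrderedGroupoid G] :
    EtaleSet G ⥤ ((MonoCat G)ᵒᵖ ⥤ Type u) where
  obj X := X.fibres
  map {X Y} F :=
    { app := fun _ => ↾fun x => ⟨Hom.toFun F x.1, (Hom.p_toFun F x.1).trans x.2⟩
      naturality := fun A B f => by
        ext x
        exact Subtype.ext (Hom.map_actHom F f.unop x.1 x.2) }

instance : (toPresheaf G).Faithful where
  map_injective {X Y F F'} h := by
    apply Hom.ext
    funext x
    have h₁ := ConcreteCategory.congr_hom (NatTrans.congr_app h (op ⟨X.p x⟩)) ⟨x, rfl⟩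
    exact congrArg Subtype.val h₁

instance : (toPresheaf G).Full where
  map_surjective {X Y} α := by
    -- The components of `α` glue to a map of total spaces, monotone by naturality at inequalities
    -- and equivariant by naturality at arrows.
    let F : X.carrier → Y.carrier := fun x => (α.app (op ⟨X.p x⟩) ⟨x, rfl⟩ : Y.fibres.obj _).1
    have hF : ∀ {A : MonoCat G} (x : X.carrier) (h : X.p x = A.obj),
        (α.app (op A) ⟨x, h⟩ : Y.fibres.obj _).1 = F x := by
      rintro ⟨a⟩ x h
      obtain rfl : X.p x = a := h
      rfl
    have hp : ∀ x, Y.p (F x) = X.p x := fun x =>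
      (α.app (op ⟨X.p x⟩) ⟨x, rfl⟩ : Y.fibres.obj _).2
    have hact : ∀ {A B : MonoCat G} (f : A ⟶ B) (x : X.carrier) (h : X.p x = B.obj),
        F (X.actHom f x h) = Y.actHom f (F x) ((hp x).trans h) := by
      rintro A ⟨b⟩ f x h
      obtain rfl : X.p x = b := h
      rw [← hF _ (X.p_actHom f x rfl)]
      exact congrArg Subtype.val (NatTrans.naturality_apply α f.op ⟨x, rfl⟩)
    refine ⟨(⟨F, ?_, hp, ?_⟩ : Hom X Y), ?_⟩
    · intro x y hxy
      have h := X.isDiscreteFibration.monotone hxy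
      exact ((congrArg F (X.actHom_ofLE h hxy rfl rfl)).symm.trans (hact (ofLE h) y rfl)).le.trans
        (Y.actHom_ofLE_le h _ (hp y))
    · intro x a b g h
      exact (congrArg F (X.actHom_ofArrow g x h)).symm.trans
        ((hact ((ofArrow G).map g) x h).trans (Y.actHom_ofArrow g _ _))
    · ext A x
      exact Subtype.ext (hF x.1 x.2).symm

section OfPresheaf

variable (P : (MonoCat G)ᵒᵖ ⥤ Type u)

/-- The elements of a presheaf on `MonoCat G`, ordered by restriction along inequalities. -/
def Elements : Type u := Σ a : G, P.obj (op ((ofArrow G).obj a))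

instance : PartialOrder (Elements P) where
  le x y := ∃ h : x.1 ≤ y.1, P.map (ofLE h).op y.2 = x.2
  le_refl x := ⟨le_rfl, by rw [ofLE_refl]; simp⟩
  le_trans := by
    rintro ⟨a, x⟩ ⟨b, y⟩ ⟨c, z⟩ ⟨h, hx⟩ ⟨h', hy⟩
    change a ≤ b at h
    change b ≤ c at h'
    obtain rfl : P.map (ofLE h).op y = x := hx
    obtain rfl : P.map (ofLE h').op z = y := hy
    refine ⟨h.trans h', ?_⟩
    simp only [← ofLE_comp_ofLE h h']
    simp
  le_antisymm := by
    rintro ⟨a, x⟩ ⟨b, y⟩ ⟨h, hx⟩ ⟨h', hy⟩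
    obtain rfl : a = b := le_antisymm h h'
    refine Sigma.ext rfl (heq_of_eq ?_)
    rw [← hx]
    simp only [ofLE_refl]
    simp

/-- The étale `G`-set of elements of a presheaf on `MonoCat G`. -/
noncomputable def ofPresheaf : EtaleSet G where
  carrier := Elements P
  p x := x.1
  isDiscreteFibration :=
    { monotone := fun _ _ h => h.1
      existsUnique_lift := by
        rintro ⟨b, y⟩ a h
        refine ⟨⟨a, P.map (ofLE h).op y⟩, ⟨⟨h, rfl⟩, rfl⟩, ?_⟩
        rintro ⟨a', x⟩ ⟨⟨h', hx⟩, rfl⟩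
        change a' ≤ b at h'
        obtain rfl : P.map (ofLE h').op y = x := hx
        rfl }
  -- As `x.1 = b`, the arrow `g : a ⟶ b` gives a morphism to `x.1` without transport along `h`.
  act x {a b} g h := ⟨a, P.map (homMk (X := ⟨a⟩) (Y := ⟨x.1⟩) g h.ge).op x.2⟩
  p_act _ _ _ _ _ := rfl
  act_id := by
    rintro ⟨a, x⟩ _ rfl
    refine Sigma.ext rfl (heq_of_eq ?_)
    exact ConcreteCategory.congr_hom (P.map_id _) x
  act_comp := by
    rintro ⟨c, x⟩ a b _ f g rfl
    refine Sigma.ext rfl (heq_of_eq ?_)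
    have h := (ofArrow G).map_comp f g
    exact (ConcreteCategory.congr_hom (congrArg (fun k => P.map k.op) h) x).trans
      (ConcreteCategory.congr_hom (P.map_comp _ _) x)
  act_mono := by
    rintro ⟨b, x⟩ ⟨d, y⟩ a _ c _ f g rfl rfl ⟨h, hx⟩ hfg
    change b ≤ d at h
    change a ⟶ b at f
    change c ⟶ d at g
    obtain rfl : P.map (ofLE h).op y = x := hx
    obtain ⟨hac, hbd, h₁⟩ := (arrLE_iff f g).1 hfg
    refine ⟨hac, ?_⟩
    have h₂ := congrArg (fun k => P.map k.op y) h₁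
    simp only [op_comp, Functor.map_comp] at h₂
    exact h₂.symm

/-- A presheaf is the presheaf of fibres of its étale set of elements. -/
lemma nonempty_iso_fibres_ofPresheaf : Nonempty (P ≅ (ofPresheaf P).fibres) := by
  let α : P ⟶ (ofPresheaf P).fibres :=
    { app := fun A => ↾fun t => ⟨(⟨A.unop.obj, t⟩ : Elements P), rfl⟩
      naturality := fun A B f => by
        ext t
        apply Subtype.ext
        let y : Elements P := ⟨(Hom.toSigma f.unop).1, P.map (ofLE (Hom.le f.unop)).op t⟩
        refine Eq.trans ?_ ((ofPresheaf P).actHom_eq (f := f.unop)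
          (x := (⟨A.unop.obj, t⟩ : Elements P)) (y := y) rfl rfl ⟨Hom.le f.unop, rfl⟩ rfl).symm
        refine Sigma.ext rfl (heq_of_eq ?_)
        have h := ofArrow_comp_ofLE (Hom.toSigma f.unop).2 (Hom.le f.unop)
        exact (ConcreteCategory.congr_hom (congrArg (fun k => P.map k.op) h.symm) t).trans
          (ConcreteCategory.congr_hom (P.map_comp _ _) t) }
  have : ∀ A, IsIso (α.app A) := by
    intro A
    rw [isIso_iff_bijective]
    constructor
    · intro t t' h
      have h₁ : (⟨A.unop.obj, t⟩ : Elements P) = ⟨A.unop.obj, t'⟩ := congrArg Subtype.val h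
      exact eq_of_heq (Sigma.mk.inj h₁).2
    · rintro ⟨⟨a, t⟩, h⟩
      obtain ⟨⟨a'⟩⟩ := A
      obtain rfl : a = a' := h
      exact ⟨t, rfl⟩
  have : IsIso α := NatIso.isIso_of_isIso_app α
  exact ⟨asIso α⟩

end OfPresheaf

instance : (toPresheaf G).EssSurj where
  mem_essImage P := ⟨ofPresheaf P, ⟨(nonempty_iso_fibres_ofPresheaf P).some.symm⟩⟩

/-- The classifying topos of `G` is the topos of presheaves on `MonoCat G`. -/
noncomputable instance : (toPresheaf G).IsEquivalence where

end EtaleSet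

/-! ### Local isomorphisms and enlargements -/

section LocalIsomorphism

variable {G K : Type u} [OrderedGroupoid G] [OrderedGroupoid K]

/-- The functor between the categories of monomorphisms induced by an ordered functor. -/
def IsOrderedFunctor.monoCatFunctor {F : G ⥤ K} (hF : IsOrderedFunctor F) :
    MonoCat G ⥤ MonoCat K where
  obj A := ⟨F.obj A.obj⟩
  map {A B} f := MonoCat.homMk (X := ⟨F.obj A.obj⟩) (Y := ⟨F.obj B.obj⟩)
    (F.map (MonoCat.Hom.toSigma f).2) (hF.obj_mono (MonoCat.Hom.le f))
  map_id A := MonoCat.hom_ext (congrArg (Sigma.mk (F.obj A.obj)) (F.map_id A.obj))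
  map_comp f g := by
    have h := arrLE_restrict (MonoCat.Hom.toSigma g).2 (MonoCat.Hom.le f)
    rw [MonoCat.homMk_comp _ _ _ (hF.map_mono _ _ h)]
    exact MonoCat.hom_ext (congrArg (Sigma.mk _) (F.map_comp _ _))

/-- Local isomorphisms induce equivalences of the categories of monomorphisms. -/
lemma IsLocalIsomorphism.nonempty_equivalence {F : G ⥤ K} (hF : IsLocalIsomorphism F) :
    Nonempty (MonoCat G ≌ MonoCat K) := by
  have := hF.full
  have := hF.faithful
  have := hF.essSurj
  let E := hF.isOrderedFunctor.monoCatFunctor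
  have hfib := hF.isDiscreteFibration_obj
  have : E.Faithful := by
    constructor
    intro A B f g h
    obtain ⟨b, k, hb, rfl⟩ := MonoCat.exists_homMk f
    obtain ⟨c, l, hc, rfl⟩ := MonoCat.exists_homMk g
    have hs : (⟨F.obj b, F.map k⟩ : Σ x : K, F.obj A.obj ⟶ x) = ⟨F.obj c, F.map l⟩ :=
      MonoCat.sigma_eq_of_homMk_eq h
    obtain rfl : b = c := (hfib.existsUnique_lift B.obj _ (hF.isOrderedFunctor.obj_mono hb)).unique
      ⟨hb, rfl⟩ ⟨hc, (congrArg Sigma.fst hs).symm⟩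
    obtain rfl : k = l := F.map_injective (eq_of_heq (Sigma.mk.inj hs).2)
    rfl
  have : E.Full := by
    constructor
    intro A B f
    obtain ⟨c, k, hc, rfl⟩ := MonoCat.exists_homMk f
    obtain ⟨b, ⟨hb, rfl⟩, -⟩ := hfib.existsUnique_lift B.obj c hc
    obtain ⟨l, rfl⟩ := F.map_surjective k
    exact ⟨MonoCat.homMk l hb, rfl⟩
  have : E.EssSurj := by
    constructor
    rintro ⟨k⟩
    obtain ⟨a, ⟨e⟩⟩ := Functor.EssSurj.mem_essImage F k
    exact ⟨⟨a⟩, ⟨(MonoCat.ofArrow K).mapIso e⟩⟩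
  have : E.IsEquivalence := { }
  exact ⟨E.asEquivalence⟩

lemma IsEnlargement.isLocalIsomorphism {i : G ⥤ K} (hi : IsEnlargement i) :
    IsLocalIsomorphism i where
  isOrderedFunctor := ⟨hi.obj_le_iff.2, fun f g => (hi.map_le_iff f g).2⟩
  full := hi.full
  faithful := hi.faithful
  essSurj := ⟨hi.exists_iso⟩
  isDiscreteFibration_obj :=
    { monotone := fun _ _ => hi.obj_le_iff.2
      existsUnique_lift := by
        intro b x hx
        obtain ⟨a, rfl⟩ := hi.isLowerSet_range hx ⟨b, rfl⟩
        exact ⟨a, ⟨hi.obj_le_iff.1 hx, rfl⟩, fun z hz => hi.injective_obj hz.2⟩ }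

end LocalIsomorphism

/-! ### The ordered groupoid of a system of inequalities -/

/-- A poset `P` indexing objects of a category `C` and its inequalities indexing monomorphisms of
`C`, in such a way that each morphism into an indexed object factors through an inequality and an
isomorphism, in a unique way up to the choice of the isomorphism. -/
structure InequalitySystem (P : Type u) [PartialOrder P] (C : Type u) [Category.{u} C] where
  /-- the object indexed by an element -/
  obj : P → C
  /-- the morphism indexed by an inequality -/
  map : ∀ {p q : P}, p ≤ q → (obj p ⟶ obj q)
  map_refl : ∀ p, map (le_refl p) = 𝟙 (obj p)
  map_comp_map : ∀ {p q r : P} (h : p ≤ q) (h' : q ≤ r), map h ≫ map h' = map (h.trans h')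
  mono_map : ∀ {p q : P} (h : p ≤ q), Mono (map h)
  existsUnique_factorization : ∀ {X : C} (p : P) (f : X ⟶ obj p),
    ∃! q, ∃ (h : q ≤ p) (e : X ≅ obj q), e.hom ≫ map h = f

namespace InequalitySystem

variable {P : Type u} [PartialOrder P] {C : Type u} [Category.{u} C]

/-- The objects of the ordered groupoid of a system `Φ` of inequalities: the indexing poset. -/
@[ext]
structure Obj (Φ : InequalitySystem P C) where
  /-- the underlying index -/
  val : P

variable {Φ : InequalitySystem P C}

instance : PartialOrder Φ.Obj := PartialOrder.lift Obj.val fun _ _ => Obj.ext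

/-- The arrows are the isomorphisms of `C` between the indexed objects, and one is below another
if the two commute with inequalities. -/
instance : OrderedGroupoid Φ.Obj where
  Hom x y := Φ.obj x.val ≅ Φ.obj y.val
  id x := Iso.refl _
  comp f g := f ≪≫ g
  inv f := f.symm
  inv_comp f := f.symm_self_id
  comp_inv f := f.self_symm_id
  ArrLE {a b c d} f g := ∃ (h : a.val ≤ c.val) (h' : b.val ≤ d.val),
    Iso.hom f ≫ Φ.map h' = Φ.map h ≫ Iso.hom g
  arrLE_refl f := ⟨le_rfl, le_rfl, by simp [map_refl]⟩
  arrLE_trans := by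
    rintro a b c d a' b' f g k ⟨h₁, h₂, e⟩ ⟨h₁', h₂', e'⟩
    refine ⟨h₁.trans h₁', h₂.trans h₂', ?_⟩
    rw [← Φ.map_comp_map h₁ h₁', ← Φ.map_comp_map h₂ h₂', reassoc_of% e, e', Category.assoc]
  arrLE_antisymm := by
    rintro a b f g ⟨h₁, h₂, e⟩ -
    apply Iso.ext
    simpa [map_refl] using e
  dom_mono _ _ h := h.1
  cod_mono _ _ h := h.2.1
  id_mono h := ⟨h, h, by simp⟩
  inv_mono := by
    rintro a b c d f g ⟨h₁, h₂, e⟩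
    refine ⟨h₂, h₁, ?_⟩
    simp only [Iso.symm_hom, Iso.inv_comp_eq]
    rw [reassoc_of% e, Iso.hom_inv_id, Category.comp_id]
  comp_mono := by
    rintro a b c a' b' c' f g f' g' ⟨h₁, h₂, e⟩ ⟨h₁', h₂', e'⟩
    refine ⟨h₁, h₂', ?_⟩
    simp [e', reassoc_of% e]
  existsUnique_restrict := by
    intro c d g a hac
    obtain ⟨q, ⟨hq, e, he⟩, huniq⟩ :=
      Φ.existsUnique_factorization d.val (Φ.map hac ≫ Iso.hom g)
    refine ⟨⟨⟨q⟩, e⟩, ⟨hac, hq, he⟩, ?_⟩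
    rintro ⟨⟨q'⟩, e'⟩ ⟨h₁, h₂, he'⟩
    obtain rfl : q' = q := huniq q' ⟨h₂, e', he'⟩
    refine Sigma.ext rfl (heq_of_eq ?_)
    have := Φ.mono_map hq
    exact Iso.ext ((cancel_mono (Φ.map hq)).1 (he'.trans he.symm))

/-- The inequalities between the objects of `G`, as monomorphisms of `MonoCat G`. -/
def ofOrderedGroupoid (G : Type u) [OrderedGroupoid G] : InequalitySystem G (MonoCat G) where
  obj := (MonoCat.ofArrow G).obj
  map h := MonoCat.ofLE h
  map_refl := MonoCat.ofLE_refl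
  map_comp_map := MonoCat.ofLE_comp_ofLE
  mono_map _ := inferInstance
  existsUnique_factorization p f := MonoCat.existsUnique_factorization p f

section Constructions

variable {P Q : Type u} [PartialOrder P] [PartialOrder Q]
  {C D : Type u} [Category.{u} C] [Category.{u} D]

/-- The image of a system of inequalities under an equivalence of categories. -/
def transport (Φ : InequalitySystem P C) (E : C ⥤ D) [E.IsEquivalence] :
    InequalitySystem P D where
  obj p := E.obj (Φ.obj p)
  map h := E.map (Φ.map h)
  map_refl p := by rw [Φ.map_refl, E.map_id]
  map_comp_map h h' := by rw [← Φ.map_comp_map h h', E.map_comp]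
  mono_map h := by
    have := Φ.mono_map h
    infer_instance
  existsUnique_factorization {X} p f := by
    let α := E.objObjPreimageIso X
    obtain ⟨q, ⟨h, e, he⟩, huniq⟩ :=
      Φ.existsUnique_factorization p (E.preimage (α.hom ≫ f))
    refine ⟨q, ⟨h, α.symm ≪≫ E.mapIso e, ?_⟩, ?_⟩
    · have h₁ := congrArg E.map he
      rw [E.map_comp, E.map_preimage] at h₁
      simp [h₁]
    · rintro q' ⟨h', e', he'⟩
      refine huniq q' ⟨h', E.preimageIso (α ≪≫ e'), E.map_injective ?_⟩
      simp [he']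

/-- Two systems of inequalities in one category form a system indexed by the disjoint union of
posets, in which elements of different summands are incomparable. -/
def sum (Φ : InequalitySystem P C) (Ψ : InequalitySystem Q C) : InequalitySystem (P ⊕ Q) C where
  obj := Sum.elim Φ.obj Ψ.obj
  map {x y} h := match x, y, h with
    | .inl _, .inl _, h => Φ.map (Sum.inl_le_inl_iff.1 h)
    | .inr _, .inr _, h => Ψ.map (Sum.inr_le_inr_iff.1 h)
    | .inl _, .inr _, h => (Sum.not_inl_le_inr h).elim
    | .inr _, .inl _, h => (Sum.not_inr_le_inl h).elim
  map_refl := by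
    rintro (p | q)
    · exact Φ.map_refl p
    · exact Ψ.map_refl q
  map_comp_map := by
    rintro (_ | _) (_ | _) (_ | _) (h | h) (h' | h')
    · exact Φ.map_comp_map h h'
    · exact Ψ.map_comp_map h h'
  mono_map := by
    rintro (_ | _) (_ | _) (h | h)
    · exact Φ.mono_map h
    · exact Ψ.mono_map h
  existsUnique_factorization := by
    rintro X (p | p) f
    · obtain ⟨q, ⟨h, e, he⟩, huniq⟩ := Φ.existsUnique_factorization p f
      refine ⟨.inl q, ⟨Sum.inl_le_inl_iff.2 h, e, he⟩, ?_⟩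
      rintro (q' | q') ⟨h', e', he'⟩
      · exact congrArg Sum.inl (huniq q' ⟨Sum.inl_le_inl_iff.1 h', e', he'⟩)
      · exact (Sum.not_inr_le_inl h').elim
    · obtain ⟨q, ⟨h, e, he⟩, huniq⟩ := Ψ.existsUnique_factorization p f
      refine ⟨.inr q, ⟨Sum.inr_le_inr_iff.2 h, e, he⟩, ?_⟩
      rintro (q' | q') ⟨h', e', he'⟩
      · exact (Sum.not_inl_le_inr h').elim
      · exact congrArg Sum.inr (huniq q' ⟨Sum.inr_le_inr_iff.1 h', e', he'⟩)

end Constructions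

section Embedding

variable {G : Type u} [OrderedGroupoid G] {P : Type u} [PartialOrder P]
  {C : Type u} [Category.{u} C]

/-- A functor from `G` to the ordered groupoid of a system `Φ` of inequalities, given by a functor
on `MonoCat G` that agrees with `Φ`, up to isomorphism, along a map of the objects of `G`. -/
noncomputable def lift (Φ : InequalitySystem P C) (E : MonoCat G ⥤ C) (ι : G → P)
    (θ : ∀ a, E.obj ((MonoCat.ofArrow G).obj a) ≅ Φ.obj (ι a)) : G ⥤ Φ.Obj where
  obj a := ⟨ι a⟩
  map {a b} f := ((θ a).symm ≪≫
    E.mapIso ((MonoCat.ofArrow G).mapIso ((Groupoid.isoEquivHom a b).symm f)) ≪≫ θ b :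
      Φ.obj (ι a) ≅ Φ.obj (ι b))
  map_id a := Iso.ext (by
    change (θ a).inv ≫ E.map ((MonoCat.ofArrow G).map (𝟙 a)) ≫ (θ a).hom = 𝟙 _
    simp)
  map_comp {a b c} f g := Iso.ext (by
    change (θ a).inv ≫ E.map ((MonoCat.ofArrow G).map (f ≫ g)) ≫ (θ c).hom =
      ((θ a).inv ≫ E.map ((MonoCat.ofArrow G).map f) ≫ (θ b).hom) ≫
        (θ b).inv ≫ E.map ((MonoCat.ofArrow G).map g) ≫ (θ c).hom
    simp)

/-- If the functor is an equivalence compatible with inequalities and the map of objects is the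
inclusion of an order ideal, then the ordered groupoid of `Φ` is an enlargement of `G`. -/
lemma isEnlargement_lift (Φ : InequalitySystem P C) (E : MonoCat G ⥤ C) [E.IsEquivalence]
    (ι : G → P) (θ : ∀ a, E.obj ((MonoCat.ofArrow G).obj a) ≅ Φ.obj (ι a))
    (hι : ∀ {a b}, ι a ≤ ι b ↔ a ≤ b) (hrange : IsLowerSet (Set.range ι))
    (hθ : ∀ {a b : G} (h : a ≤ b),
      (θ a).hom ≫ Φ.map (hι.2 h) = E.map (MonoCat.ofLE h) ≫ (θ b).hom) :
    IsEnlargement (Φ.lift E ι θ) where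
  injective_obj a b h := by
    have h₁ : ι a = ι b := congrArg Obj.val h
    exact le_antisymm (hι.1 h₁.le) (hι.1 h₁.ge)
  obj_le_iff := hι
  map_le_iff {a b c d} f g := by
    refine Iff.trans ?_ (MonoCat.arrLE_iff f g).symm
    -- By naturality of `θ`, one of the two squares of inequalities is the image of the other.
    have key : ∀ (h : a ≤ c) (h' : b ≤ d),
        ((θ a).inv ≫ E.map ((MonoCat.ofArrow G).map f) ≫ (θ b).hom) ≫ Φ.map (hι.2 h') =
          Φ.map (hι.2 h) ≫ (θ c).inv ≫ E.map ((MonoCat.ofArrow G).map g) ≫ (θ d).hom ↔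
        (MonoCat.ofArrow G).map f ≫ MonoCat.ofLE h' =
          MonoCat.ofLE h ≫ (MonoCat.ofArrow G).map g := by
      intro h h'
      have h₁ : Φ.map (hι.2 h) = (θ a).inv ≫ E.map (MonoCat.ofLE h) ≫ (θ c).hom := by
        rw [← hθ, Iso.inv_hom_id_assoc]
      rw [Category.assoc, Category.assoc, hθ, h₁]
      simp only [Category.assoc, Iso.hom_inv_id_assoc, Iso.cancel_iso_inv_left]
      rw [← Category.assoc, ← Category.assoc, Iso.cancel_iso_hom_right, ← E.map_comp,
        ← E.map_comp, E.map_injective.eq_iff]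
    constructor
    · rintro ⟨h, h', e⟩
      exact ⟨hι.1 h, hι.1 h', (key _ _).1 e⟩
    · rintro ⟨h, h', e⟩
      exact ⟨hι.2 h, hι.2 h', (key h h').2 e⟩
  full := by
    constructor
    intro a b f
    change Φ.obj (ι a) ≅ Φ.obj (ι b) at f
    obtain ⟨k, hk⟩ := MonoCat.exists_ofArrow_map_eq (E.preimageIso (θ a ≪≫ f ≪≫ (θ b).symm))
    refine ⟨k, Iso.ext ?_⟩
    change (θ a).inv ≫ E.map ((MonoCat.ofArrow G).map k) ≫ (θ b).hom = f.hom
    rw [hk]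
    simp
  faithful := by
    constructor
    intro a b f g h
    have h₁ : (θ a).inv ≫ E.map ((MonoCat.ofArrow G).map f) ≫ (θ b).hom =
      (θ a).inv ≫ E.map ((MonoCat.ofArrow G).map g) ≫ (θ b).hom := congrArg Iso.hom h
    simp only [Iso.cancel_iso_inv_left, Iso.cancel_iso_hom_right] at h₁
    exact (MonoCat.ofArrow G).map_injective (E.map_injective h₁)
  isLowerSet_range := by
    rintro _ ⟨q⟩ hq ⟨a, rfl⟩
    obtain ⟨b, rfl⟩ := hrange (show q ≤ ι a from hq) ⟨a, rfl⟩
    exact ⟨b, rfl⟩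
  exists_iso := by
    rintro ⟨p⟩
    obtain ⟨⟨a⟩, ⟨e⟩⟩ := Functor.EssSurj.mem_essImage E (Φ.obj p)
    refine ⟨a, ⟨(Groupoid.isoEquivHom _ _).symm ?_⟩⟩
    exact ((θ a).symm ≪≫ e : Φ.obj (ι a) ≅ Φ.obj p)

end Embedding

end InequalitySystem

/-! ### The three equivalent conditions -/

/-- An equivalence between the categories of monomorphisms of `G` and `H` provides the arrows
between objects of `G` and objects of `H` in a joint bipartite enlargement. -/
theorem exists_isBipartiteEnlargement {G H : Type u} [OrderedGroupoid G] [OrderedGroupoid H]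
    (E : MonoCat G ≌ MonoCat H) :
    ∃ (K : Type u) (_ : OrderedGroupoid K) (i : G ⥤ K) (j : H ⥤ K),
      IsBipartiteEnlargement i j := by
  let Φ := ((InequalitySystem.ofOrderedGroupoid G).transport E.functor).sum
    (InequalitySystem.ofOrderedGroupoid H)
  let i : G ⥤ Φ.Obj := Φ.lift E.functor Sum.inl fun _ => Iso.refl _
  let j : H ⥤ Φ.Obj := Φ.lift (𝟭 _) Sum.inr fun _ => Iso.refl _
  have hi : IsEnlargement i := by
    refine Φ.isEnlargement_lift _ _ _ Sum.inl_le_inl_iff ?_ ?_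
    · rintro _ (q | q) h ⟨a, rfl⟩
      · exact ⟨q, rfl⟩
      · exact (Sum.not_inr_le_inl h).elim
    · intro a b h
      exact (Category.id_comp _).trans (Category.comp_id _).symm
  have hj : IsEnlargement j := by
    refine Φ.isEnlargement_lift _ _ _ Sum.inr_le_inr_iff ?_ ?_
    · rintro _ (q | q) h ⟨a, rfl⟩
      · exact (Sum.not_inl_le_inr h).elim
      · exact ⟨q, rfl⟩
    · intro a b h
      exact (Category.id_comp _).trans (Category.comp_id _).symm
  refine ⟨Φ.Obj, inferInstance, i, j, hi, hj, ?_, ?_, ?_⟩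
  · refine ⟨Set.disjoint_left.2 ?_, codisjoint_iff.2 (Set.eq_univ_of_forall ?_)⟩
    · rintro _ ⟨a, rfl⟩ ⟨b, hb⟩
      exact Sum.inr_ne_inl (congrArg InequalitySystem.Obj.val hb)
    · rintro ⟨a | b⟩
      · exact Or.inl ⟨a, rfl⟩
      · exact Or.inr ⟨b, rfl⟩
  · intro a
    obtain ⟨b, ⟨e⟩⟩ := hj.exists_iso (i.obj a)
    exact ⟨b, ⟨e.inv⟩⟩
  · intro b
    obtain ⟨a, ⟨e⟩⟩ := hi.exists_iso (j.obj b)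
    exact ⟨a, ⟨e.inv⟩⟩

end OrderedGroupoid

theorem mainTheorem3 (G H : Type u) [OrderedGroupoid G] [OrderedGroupoid H] :
    List.TFAE [
      Nonempty (OrderedGroupoid.EtaleSet G ≌ OrderedGroupoid.EtaleSet H),
      ∃ (K : Type u) (_ : OrderedGroupoid K) (i : G ⥤ K) (j : H ⥤ K),
        OrderedGroupoid.IsBipartiteEnlargement i j,
      ∃ (K : Type u) (_ : OrderedGroupoid K) (i : G ⥤ K) (j : H ⥤ K),
        OrderedGroupoid.IsLocalIsomorphism i ∧ OrderedGroupoid.IsLocalIsomorphism j] := by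
  tfae_have 1 → 2
  | ⟨E⟩ => by
    obtain ⟨E'⟩ := nonempty_equivalence_of_presheaf
      (C := OrderedGroupoid.MonoCat G) (D := OrderedGroupoid.MonoCat H)
      (fun _ => inferInstance) (fun _ => inferInstance)
      ((OrderedGroupoid.EtaleSet.toPresheaf G).asEquivalence.symm.trans
        (E.trans (OrderedGroupoid.EtaleSet.toPresheaf H).asEquivalence))
    exact OrderedGroupoid.exists_isBipartiteEnlargement E'
  tfae_have 2 → 3
  | ⟨K, hK, i, j, h⟩ => ⟨K, hK, i, j, h.left.isLocalIsomorphism, h.right.isLocalIsomorphism⟩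
  tfae_have 3 → 1
  | ⟨K, hK, i, j, hi, hj⟩ => by
    obtain ⟨E⟩ := hi.nonempty_equivalence
    obtain ⟨E'⟩ := hj.nonempty_equivalence
    exact ⟨(OrderedGroupoid.EtaleSet.toPresheaf G).asEquivalence.trans
      ((E.trans E'.symm).op.congrLeft.trans
        (OrderedGroupoid.EtaleSet.toPresheaf H).asEquivalence.symm)⟩
  tfae_finish
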